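/- Let $X$ be a smooth (real, finite-dimensional) manifold and let $(J,g)$ be a Kähler structure on $X$: $J$ is a smooth almost complex structure, $g$ is a smooth Riemannian metric with $g(J\cdot,J\cdot)=g$, and $\nabla_g J=0$, where $\nabla_g$ is the Levi-Civita connection of $g$. For a smooth section $S$ of $\mathrm{End}_{\mathbb R}(T_X)$ write $\nabla_g S(\xi,\eta):=\nabla_\xi(S\eta)-S\,\nabla_\xi\eta$ and $$\nabla^{1,0}_{g,J}S(\xi,\eta):=\tfrac12\big[\nabla_gS(\xi,\eta)-J\,\nabla_gS(J\xi,\eta)\big],\qquad \nabla^{0,1}_{g,J}S(\xi,\eta):=\tfrac12\big[\nabla_gS(\xi,\eta)+J\,\nabla_gS(J\xi,\eta)\big],$$ and let $\nabla^{0,1}_{g,J}S\cdot\eta$ be the endomorphism $\xi\mapsto\nabla^{0,1}_{g,J}S(\xi,\eta)$. Let $L_g^T$ denote the transpose of an endomorphism $L$ of $T_X$ with respect to $g$. Let $\overline\partial_{T_{X,J}}$ be the $\overline\partial$-operator of the holomorphic tangent bundle $T_{X,J}\cong T^{1,0}_{X,J}$ acting on $T_{X,J}$-valued forms, and let $\partial^g_{T_{X,J}}$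 be the $(1,0)$-part of the covariant exterior derivative $\nabla_{T_X,g}S(\xi,\eta)=\nabla_\xi(S\eta)-\nabla_\eta(S\xi)-S[\xi,\eta]$, so that $\nabla_{T_X,g}=\partial^g_{T_{X,J}}+\overline\partial_{T_{X,J}}$. (1) Let $A$ be a smooth $J$-antilinear section of $\mathrm{End}_{\mathbb R}(T_X)$ with $A=A_g^T$. Then the following conditions are equivalent: (a) $\nabla^{0,1}_{g,J}A\cdot\xi=\big(\nabla^{0,1}_{g,J}A\cdot\xi\big)_g^T$ for all $\xi\in T_X$; (b) $\nabla^{0,1}_{g,J}A(\xi,\eta)=\nabla^{0,1}_{g,J}A(\eta,\xi)$ for all $\xi,\eta$ (that is, $\nabla^{0,1}_{g,J}A$ is a section of $S^2_{\mathbb R}T_X^*\otimes T_X$); (c) $\overline\partial_{T_{X,J}}A\equiv0$. (2) Let $B$ be a smooth $J$-linear section of $\mathrm{End}_{\mathbb R}(T_X)$ with $B=B_g^T$. Then the following conditions are equivalent: (a) $\nabla^{0,1}_{g,J}B\cdot\xi=\big(\nabla^{0,1}_{g,J}B\cdot\xi\big)_g^T$ for all $\xi\in T_X$; (b) $\nabla^{1,0}_{g,J}B(\xi,\eta)=\nabla^{1,0}_{g,J}B(\eta,\xi)$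 for all $\xi,\eta$ (that is, $\nabla^{1,0}_{g,J}B$ is a section of $S^2_{\mathbb R}T_X^*\otimes T_X$); (c) $\partial^g_{T_{X,J}}B\equiv0$. -/

import Mathlib

open Bundle NormedSpace VectorField
open scoped Manifold ContDiff Topology

noncomputable section KahlerGeometry

set_option linter.unusedSectionVars false

variable {E : Type*} [NormedAddCommGroup E] [NormedSpace ℝ E] 
  {H : Type*} [TopologicalSpace H] {I : ModelWithCorners ℝ E H}
  {M : Type*} [TopologicalSpace M] [ChartedSpace H M] [IsManifold I ∞ M]

/-- Smooth Riemannian metrics on `M`. -/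
abbrev SmoothMetric (I : ModelWithCorners ℝ E H) (M : Type*) [TopologicalSpace M]
    [ChartedSpace H M] [IsManifold I ∞ M] :=
  ContMDiffRiemannianMetric I ∞ E (fun x : M ↦ TangentSpace I x)

/-- Smooth sections of `End_ℝ(T_M)`. -/
abbrev SmoothEnd (I : ModelWithCorners ℝ E H) (M : Type*) [TopologicalSpace M]
    [ChartedSpace H M] [IsManifold I ∞ M] :=
  ContMDiffSection I (E →L[ℝ] E) ∞ (fun x : M ↦ TangentSpace I x →L[ℝ] TangentSpace I x)

theorem SmoothMetric.mdifferentiableAt (g : SmoothMetric I M) {X Y : Π x : M, TangentSpace I x}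
    {x : M} (hX : MDiffAt (T% X) x) (hY : MDiffAt (T% Y) x) :
    MDiffAt (fun y ↦ g.inner y (X y) (Y y)) x := by
  have : MDifferentiableAt I (I.prod 𝓘(ℝ)) 
      (fun m ↦ TotalSpace.mk' ℝ (E := Bundle.Trivial M ℝ) m (g.inner m (X m) (Y m))) x := by
    apply MDifferentiableAt.clm_bundle_apply₂ (F₁ := E) (F₂ := E)
    · exact (g.contMDiff x).mdifferentiableAt (by simp)
    · exact hX
    · exact hY
  simp only [mdifferentiableAt_totalSpace] at this
  exact this.2


variable [FiniteDimensional ℝ E]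

theorem SmoothMetric.flat_bijective (g : SmoothMetric I M) (x : M) :
    Function.Bijective (g.inner x) := by
  have hfd : FiniteDimensional ℝ (TangentSpace I x) := inferInstanceAs (FiniteDimensional ℝ E)
  have ht2 : T2Space (TangentSpace I x) := inferInstanceAs (T2Space E)
  have inj : Function.Injective (g.inner x) := by
    refine (injective_iff_map_eq_zero (g.inner x)).2 fun v hv ↦ ?_
    by_contra h
    have := g.pos x v h
    rw [hv] at this
    simp at this
  let e : (TangentSpace I x →L[ℝ] ℝ) ≃ₗ[ℝ] (TangentSpace I x →ₗ[ℝ] ℝ) :=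
    LinearMap.toContinuousLinearMap.symm
  have inj' : Function.Injective (e.toLinearMap ∘ₗ (g.inner x).toLinearMap) :=
    e.injective.comp inj
  have surj := (LinearMap.injective_iff_surjective_of_finrank_eq_finrank
    (Subspace.dual_finrank_eq (K := ℝ) (V := TangentSpace I x)).symm).1 inj'
  refine ⟨inj, fun φ ↦ ?_⟩
  obtain ⟨v, hv⟩ := surj (e φ)
  exact ⟨v, e.injective hv⟩

/-- The isomorphism `g : T_x → T_x^*`, `v ↦ g(v, ·)`, given by the metric. -/
def SmoothMetric.flat (g : SmoothMetric I M) (x : M) :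
    TangentSpace I x ≃ₗ[ℝ] (TangentSpace I x →L[ℝ] ℝ) :=
  LinearEquiv.ofBijective (g.inner x).toLinearMap (g.flat_bijective x)

theorem SmoothMetric.inner_flat_symm (g : SmoothMetric I M) (x : M)
    (φ : TangentSpace I x →L[ℝ] ℝ) (w : TangentSpace I x) :
    g.inner x ((g.flat x).symm φ) w = φ w :=
  congr($((g.flat x).apply_symm_apply φ) w)

/-- `∇` is a Levi-Civita connection of `g`: it is torsion-free and `∇ g = 0`. -/
structure IsLeviCivita (g : SmoothMetric I M)
    (cov : CovariantDerivative I E (fun x : M ↦ TangentSpace I x)) : Prop where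
  torsion_free : ∀ (x : M) (X Y : Π x : M, TangentSpace I x),
    MDiffAt (T% X) x → MDiffAt (T% Y) x →
      cov Y x (X x) - cov X x (Y x) = mlieBracket I X Y x
  metric : ∀ (x : M) (v : TangentSpace I x) (Y Z : Π x : M, TangentSpace I x),
    MDiffAt (T% Y) x → MDiffAt (T% Z) x →
      mvfderiv I (fun y ↦ g.inner y (Y y) (Z y)) x v =
        g.inner x (cov Y x v) (Z x) + g.inner x (Y x) (cov Z x v)

/-- The right-hand side of the Koszul formula for `2 g(∇_X Y, Z)`. -/
def SmoothMetric.koszul (g : SmoothMetric I M) (Y X Z : Π x : M, TangentSpace I x) (x : M) : ℝ :=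
  mvfderiv I (fun y ↦ g.inner y (Y y) (Z y)) x (X x)
    + mvfderiv I (fun y ↦ g.inner y (X y) (Z y)) x (Y x)
    - mvfderiv I (fun y ↦ g.inner y (X y) (Y y)) x (Z x)
    + g.inner x (mlieBracket I X Y x) (Z x)
    - g.inner x (mlieBracket I X Z x) (Y x)
    - g.inner x (mlieBracket I Y Z x) (X x)

theorem SmoothMetric.koszul_tensorial_left (g : SmoothMetric I M)
    {Y Z : Π x : M, TangentSpace I x} {x : M} (hY : MDiffAt (T% Y) x) (hZ : MDiffAt (T% Z) x) :
    TensorialAt I E (fun X ↦ g.koszul Y X Z x) x where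
  smul {f X} hf hX := by
    have h1 := mvfderiv_fun_mul hf (g.mdifferentiableAt hX hZ)
    have h2 := mvfderiv_fun_mul hf (g.mdifferentiableAt hX hY)
    simp only [koszul, Pi.smul_apply', map_smul, smul_apply, smul_eq_mul,
      h1, h2, mlieBracket_smul_left hf hX, map_add, add_apply]
    ring
  add {X X'} hX hX' := by
    have h1 := mvfderiv_fun_add (g.mdifferentiableAt hX hZ) (g.mdifferentiableAt hX' hZ)
    have h2 := mvfderiv_fun_add (g.mdifferentiableAt hX hY) (g.mdifferentiableAt hX' hY)
    simp only [koszul, Pi.add_apply, add_apply, h1, h2,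
      mlieBracket_add_left hX hX', map_add]
    ring

theorem SmoothMetric.koszul_tensorial_right (g : SmoothMetric I M)
    {Y X : Π x : M, TangentSpace I x} {x : M} (hY : MDiffAt (T% Y) x) (hX : MDiffAt (T% X) x) :
    TensorialAt I E (fun Z ↦ g.koszul Y X Z x) x where
  smul {f Z} hf hZ := by
    have h1 := mvfderiv_fun_mul hf (g.mdifferentiableAt hY hZ)
    have h2 := mvfderiv_fun_mul hf (g.mdifferentiableAt hX hZ)
    simp only [koszul, Pi.smul_apply', map_smul, smul_apply, smul_eq_mul,
      h1, h2, mlieBracket_smul_right hf hZ, map_add, add_apply]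
    rw [g.symm x (X x) (Z x), g.symm x (Y x) (Z x)]
    ring
  add {Z Z'} hZ hZ' := by
    have h1 := mvfderiv_fun_add (g.mdifferentiableAt hY hZ) (g.mdifferentiableAt hY hZ')
    have h2 := mvfderiv_fun_add (g.mdifferentiableAt hX hZ) (g.mdifferentiableAt hX hZ')
    simp only [koszul, Pi.add_apply, add_apply, h1, h2,
      mlieBracket_add_right hZ hZ', map_add]
    ring

theorem SmoothMetric.koszul_add (g : SmoothMetric I M)
    {Y Y' X Z : Π x : M, TangentSpace I x} {x : M} (hY : MDiffAt (T% Y) x)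
    (hY' : MDiffAt (T% Y') x) (hX : MDiffAt (T% X) x) (hZ : MDiffAt (T% Z) x) :
    g.koszul (Y + Y') X Z x = g.koszul Y X Z x + g.koszul Y' X Z x := by
  have h1 := mvfderiv_fun_add (g.mdifferentiableAt hY hZ) (g.mdifferentiableAt hY' hZ)
  have h2 := mvfderiv_fun_add (g.mdifferentiableAt hX hY) (g.mdifferentiableAt hX hY')
  simp only [koszul, Pi.add_apply, add_apply, h1, h2,
    mlieBracket_add_right hY hY', mlieBracket_add_left hY hY', map_add]
  ring

theorem SmoothMetric.koszul_smul (g : SmoothMetric I M) {f : M → ℝ}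
    {Y X Z : Π x : M, TangentSpace I x} {x : M} (hf : MDiffAt f x) (hY : MDiffAt (T% Y) x)
    (hX : MDiffAt (T% X) x) (hZ : MDiffAt (T% Z) x) :
    g.koszul (f • Y) X Z x =
      f x * g.koszul Y X Z x + 2 * mvfderiv I f x (X x) * g.inner x (Y x) (Z x) := by
  have h1 := mvfderiv_fun_mul hf (g.mdifferentiableAt hY hZ)
  have h2 := mvfderiv_fun_mul hf (g.mdifferentiableAt hX hY)
  simp only [koszul, Pi.smul_apply', map_smul, smul_apply, smul_eq_mul,
    h1, h2, mlieBracket_smul_right hf hY, mlieBracket_smul_left hf hY, map_add,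
    add_apply]
  rw [g.symm x (Y x) (X x)]
  ring

theorem exists_isLeviCivita (g : SmoothMetric I M) :
    ∃ cov : CovariantDerivative I E (fun x : M ↦ TangentSpace I x), IsLeviCivita g cov := by
  classical
  let K (Y : Π x : M, TangentSpace I x) (x : M) :
      TangentSpace I x →L[ℝ] TangentSpace I x →L[ℝ] ℝ :=
    if hY : MDiffAt (T% Y) x then
      TensorialAt.mkHom₂ (fun X Z ↦ g.koszul Y X Z x) x
        (fun _ hZ ↦ g.koszul_tensorial_left hY hZ) (fun _ hX ↦ g.koszul_tensorial_right hY hX)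
    else 0
  have K_apply {Y X Z : Π x : M, TangentSpace I x} {x : M} (hY : MDiffAt (T% Y) x)
      (hX : MDiffAt (T% X) x) (hZ : MDiffAt (T% Z) x) :
      K Y x (X x) (Z x) = g.koszul Y X Z x := by
    simp only [K, dif_pos hY]
    exact TensorialAt.mkHom₂_apply _ _ hX hZ
  have hfd (x : M) : FiniteDimensional ℝ (TangentSpace I x) :=
    inferInstanceAs (FiniteDimensional ℝ E)
  have ht2 (x : M) : T2Space (TangentSpace I x) := inferInstanceAs (T2Space E)
  let D (Y : Π x : M, TangentSpace I x) (x : M) : TangentSpace I x →L[ℝ] TangentSpace I x :=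
    LinearMap.toContinuousLinearMap
      ((1 / 2 : ℝ) • ((g.flat x).symm.toLinearMap ∘ₗ (K Y x).toLinearMap))
  have D_inner (Y : Π x : M, TangentSpace I x) (x : M) (v w : TangentSpace I x) :
      g.inner x (D Y x v) w = K Y x v w / 2 := by
    have : D Y x v = (1 / 2 : ℝ) • (g.flat x).symm (K Y x v) := rfl
    rw [this, map_smul, smul_apply, g.inner_flat_symm, smul_eq_mul]
    ring
  have D_apply {Y X Z : Π x : M, TangentSpace I x} {x : M} (hY : MDiffAt (T% Y) x)
      (hX : MDiffAt (T% X) x) (hZ : MDiffAt (T% Z) x) :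
      g.inner x (D Y x (X x)) (Z x) = g.koszul Y X Z x / 2 := by
    rw [D_inner, K_apply hY hX hZ]
  have ext_of {x : M} {a b : TangentSpace I x}
      (h : ∀ Z : Π x : M, TangentSpace I x, MDiffAt (T% Z) x →
        g.inner x a (Z x) = g.inner x b (Z x)) : a = b := by
    apply (g.flat_bijective x).1
    ext w
    simpa using h (FiberBundle.extend E w) (FiberBundle.mdifferentiableAt_extend ..)
  let cov : CovariantDerivative I E (fun x : M ↦ TangentSpace I x) :=
    { toFun := D
      isCovariantDerivativeOnUniv :=
        { add := by
            intro Y Y' x hY hY' _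
            ext v
            obtain ⟨X, hX, rfl⟩ : ∃ X : Π x : M, TangentSpace I x, MDiffAt (T% X) x ∧ X x = v :=
              ⟨FiberBundle.extend E v, FiberBundle.mdifferentiableAt_extend .., by simp⟩
            refine ext_of fun Z hZ ↦ ?_
            rw [add_apply, map_add, add_apply,
              D_apply (mdifferentiableAt_add_section hY hY') hX hZ, D_apply hY hX hZ,
              D_apply hY' hX hZ, g.koszul_add hY hY' hX hZ]
            ring
          leibniz := by
            intro Y f x hY hf _
            ext v
            obtain ⟨X, hX, rfl⟩ : ∃ X : Π x : M, TangentSpace I x, MDiffAt (T% X) x ∧ X x = v :=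
              ⟨FiberBundle.extend E v, FiberBundle.mdifferentiableAt_extend .., by simp⟩
            refine ext_of fun Z hZ ↦ ?_
            rw [add_apply, map_add, add_apply,
              D_apply (hf.smul_section hY) hX hZ, smul_apply, map_smul,
              smul_apply, D_apply hY hX hZ,
              ContinuousLinearMap.smulRight_apply, map_smul,
              smul_apply, g.koszul_smul hf hY hX hZ]
            simp only [smul_eq_mul]
            ring } }
  refine ⟨cov, ⟨fun x X Y hX hY ↦ ext_of fun Z hZ ↦ ?_, fun x v Y Z hY hZ ↦ ?_⟩⟩
  · change g.inner x (D Y x (X x) - D X x (Y x)) (Z x) = _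
    rw [map_sub, sub_apply, D_apply hY hX hZ, D_apply hX hY hZ]
    simp only [SmoothMetric.koszul]
    rw [mlieBracket_swap_apply (V := Y) (W := X)]
    simp only [g.symm _ (Y _) (X _), map_neg, neg_apply]
    ring
  · obtain ⟨X, hX, rfl⟩ : ∃ X : Π x : M, TangentSpace I x, MDiffAt (T% X) x ∧ X x = v :=
      ⟨FiberBundle.extend E v, FiberBundle.mdifferentiableAt_extend .., by simp⟩
    change _ = g.inner x (D Y x (X x)) (Z x) + g.inner x (Y x) (D Z x (X x))
    rw [g.symm x (Y x), D_apply hY hX hZ, D_apply hZ hX hY]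
    simp only [SmoothMetric.koszul]
    rw [mlieBracket_swap_apply (V := Z) (W := Y)]
    simp only [g.symm _ (Z _) (Y _), map_neg, neg_apply]
    ring

/-- The Levi-Civita connection of `g`. -/
def leviCivita (g : SmoothMetric I M) : CovariantDerivative I E (fun x : M ↦ TangentSpace I x) :=
  (exists_isLeviCivita g).choose

theorem isLeviCivita_leviCivita (g : SmoothMetric I M) : IsLeviCivita g (leviCivita g) :=
  (exists_isLeviCivita g).choose_spec

/-- The transpose `L_g^T = g⁻¹ L^* g` of an endomorphism `L` of `T_x` with respect to `g`. -/
def SmoothMetric.transpose (g : SmoothMetric I M) (x : M)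
    (L : TangentSpace I x →L[ℝ] TangentSpace I x) : TangentSpace I x →L[ℝ] TangentSpace I x :=
  haveI : FiniteDimensional ℝ (TangentSpace I x) := inferInstanceAs (FiniteDimensional ℝ E)
  haveI : T2Space (TangentSpace I x) := inferInstanceAs (T2Space E)
  LinearMap.toContinuousLinearMap
    { toFun := fun v ↦ (g.flat x).symm ((g.flat x v).comp L)
      map_add' := fun v w ↦ by
        rw [map_add, ContinuousLinearMap.add_comp, map_add]
      map_smul' := fun c v ↦ by
        rw [map_smul, ContinuousLinearMap.smul_comp, map_smul, RingHom.id_apply] }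

theorem SmoothMetric.inner_transpose (g : SmoothMetric I M) (x : M)
    (L : TangentSpace I x →L[ℝ] TangentSpace I x) (v w : TangentSpace I x) :
    g.inner x (g.transpose x L v) w = g.inner x v (L w) :=
  g.inner_flat_symm x ((g.flat x v).comp L) w

/-- The vector field `S η`. -/
def SmoothEnd.onField (S : SmoothEnd I M) (η : Π x : M, TangentSpace I x) :
    Π x : M, TangentSpace I x :=
  fun x ↦ S x (η x)

theorem SmoothEnd.mdifferentiableAt_onField (S : SmoothEnd I M) {η : Π x : M, TangentSpace I x}
    {x : M} (hη : MDiffAt (T% η) x) : MDiffAt (T% (S.onField η)) x :=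
  MDifferentiableAt.clm_bundle_apply (F₁ := E) (F₂ := E)
    ((S.contMDiff x).mdifferentiableAt (by simp)) hη

theorem SmoothEnd.covDeriv_tensorial (g : SmoothMetric I M) (S : SmoothEnd I M) (x : M) :
    TensorialAt I E (fun η : Π x : M, TangentSpace I x ↦
      leviCivita g (S.onField η) x - (S x).comp (leviCivita g η x)) x where
  smul {f η} hf hη := by
    have h : S.onField (f • η) = f • S.onField η := by
      funext y; simp [SmoothEnd.onField]
    rw [h, (leviCivita g).isCovariantDerivativeOnUniv.leibniz (S.mdifferentiableAt_onField hη) hf,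
      (leviCivita g).isCovariantDerivativeOnUniv.leibniz hη hf]
    ext v
    simp [SmoothEnd.onField, smul_sub]
  add {η η'} hη hη' := by
    have h : S.onField (η + η') = S.onField η + S.onField η' := by
      funext y; simp [SmoothEnd.onField]
    rw [h, (leviCivita g).isCovariantDerivativeOnUniv.add (S.mdifferentiableAt_onField hη)
      (S.mdifferentiableAt_onField hη'),
      (leviCivita g).isCovariantDerivativeOnUniv.add hη hη', ContinuousLinearMap.comp_add]
    abel

/-- The endomorphism `∇_g S · η : ξ ↦ ∇_g S (ξ, η)` of `T_x`, where
`∇_g S (ξ, η) = ∇_ξ (S η) - S (∇_ξ η)`. -/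
def covDot (g : SmoothMetric I M) (S : SmoothEnd I M) (x : M) (η : TangentSpace I x) :
    TangentSpace I x →L[ℝ] TangentSpace I x :=
  TensorialAt.mkHom _ x (SmoothEnd.covDeriv_tensorial g S x) η

theorem covDot_apply (g : SmoothMetric I M) (S : SmoothEnd I M) {x : M}
    {η : Π x : M, TangentSpace I x} (hη : MDiffAt (T% η) x) (v : TangentSpace I x) :
    covDot g S x (η x) v = leviCivita g (S.onField η) x v - S x (leviCivita g η x v) :=
  congr($(TensorialAt.mkHom_apply (SmoothEnd.covDeriv_tensorial g S x) hη) v)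

/-- `∇^{1,0}_{g,J} S · η : ξ ↦ ½ (∇_g S (ξ, η) - J ∇_g S (J ξ, η))`. -/
def cov10Dot (g : SmoothMetric I M) (J S : SmoothEnd I M) (x : M) (η : TangentSpace I x) :
    TangentSpace I x →L[ℝ] TangentSpace I x :=
  (1 / 2 : ℝ) • (covDot g S x η - (J x).comp ((covDot g S x η).comp (J x)))

/-- `∇^{0,1}_{g,J} S · η : ξ ↦ ½ (∇_g S (ξ, η) + J ∇_g S (J ξ, η))`. -/
def cov01Dot (g : SmoothMetric I M) (J S : SmoothEnd I M) (x : M) (η : TangentSpace I x) :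
    TangentSpace I x →L[ℝ] TangentSpace I x :=
  (1 / 2 : ℝ) • (covDot g S x η + (J x).comp ((covDot g S x η).comp (J x)))

/-- The tensor `∇^{1,0}_{g,J} S (ξ, η)`. -/
def cov10 (g : SmoothMetric I M) (J S : SmoothEnd I M) (x : M) (ξ η : TangentSpace I x) :
    TangentSpace I x :=
  cov10Dot g J S x η ξ

/-- The tensor `∇^{0,1}_{g,J} S (ξ, η)`. -/
def cov01 (g : SmoothMetric I M) (J S : SmoothEnd I M) (x : M) (ξ η : TangentSpace I x) :
    TangentSpace I x :=
  cov01Dot g J S x η ξ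

/-- `(J, g)` is a Kähler structure: `J` is an almost complex structure, `g = J^* g J` and
`∇_g J = 0`. -/
structure IsKahler (J : SmoothEnd I M) (g : SmoothMetric I M) : Prop where
  sq : ∀ (x : M) (v : TangentSpace I x), J x (J x v) = -v
  invariant : ∀ (x : M) (v w : TangentSpace I x), g.inner x (J x v) (J x w) = g.inner x v w
  parallel : ∀ (x : M) (η : TangentSpace I x), covDot g J x η = 0

/-! Complex vector fields: the pair `(U, V)` stands for the section `U + i V` of `T_X ⊗ ℂ`. -/

/-- The `ℂ`-bilinear extension of the Lie bracket, `[U + i V, U' + i V']`. -/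
def bracketC (Z W : (Π x : M, TangentSpace I x) × (Π x : M, TangentSpace I x)) :
    (Π x : M, TangentSpace I x) × (Π x : M, TangentSpace I x) :=
  (fun x ↦ mlieBracket I Z.1 W.1 x - mlieBracket I Z.2 W.2 x,
   fun x ↦ mlieBracket I Z.1 W.2 x + mlieBracket I Z.2 W.1 x)

/-- `ξ^{1,0} = ½ (ξ - i J ξ)`. -/
def toC10 (J : SmoothEnd I M) (ξ : Π x : M, TangentSpace I x) :
    (Π x : M, TangentSpace I x) × (Π x : M, TangentSpace I x) :=
  ((1 / 2 : ℝ) • ξ, (-1 / 2 : ℝ) • J.onField ξ)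

/-- `ξ^{0,1} = ½ (ξ + i J ξ)`. -/
def toC01 (J : SmoothEnd I M) (ξ : Π x : M, TangentSpace I x) :
    (Π x : M, TangentSpace I x) × (Π x : M, TangentSpace I x) :=
  ((1 / 2 : ℝ) • ξ, (1 / 2 : ℝ) • J.onField ξ)

/-- The real field `ζ = U + J V` with `ζ^{1,0} = Z^{1,0}` for `Z = U + i V`: the `(1,0)`-component
of `Z` under the identification `T^{1,0}_{X,J} ≅ T_X`. -/
def real10 (J : SmoothEnd I M)
    (Z : (Π x : M, TangentSpace I x) × (Π x : M, TangentSpace I x)) : Π x : M, TangentSpace I x :=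
  fun x ↦ Z.1 x + J x (Z.2 x)

/-- The real field `ζ = U - J V` with `ζ^{0,1} = Z^{0,1}` for `Z = U + i V`. -/
def real01 (J : SmoothEnd I M)
    (Z : (Π x : M, TangentSpace I x) × (Π x : M, TangentSpace I x)) : Π x : M, TangentSpace I x :=
  fun x ↦ Z.1 x - J x (Z.2 x)

/-- The `∂̄`-operator of `T_{X,J} ≅ T^{1,0}_{X,J}` on vector fields:
`(∂̄ η)(ξ) = [ξ^{0,1}, η^{1,0}]^{1,0}`. -/
def dbarField (J : SmoothEnd I M) (ξ η : Π x : M, TangentSpace I x) : Π x : M, TangentSpace I x :=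
  real10 J (bracketC (toC01 J ξ) (toC10 J η))

/-- The `J`-linear component `S^{1,0} ζ = ½ (S - J S J) ζ`. -/
def part10 (J S : SmoothEnd I M) (ζ : Π x : M, TangentSpace I x) :
    Π x : M, TangentSpace I x :=
  fun x ↦ (1 / 2 : ℝ) • (S x (ζ x) - J x (S x (J x (ζ x))))

/-- The `J`-antilinear component `S^{0,1} ζ = ½ (S + J S J) ζ`. -/
def part01 (J S : SmoothEnd I M) (ζ : Π x : M, TangentSpace I x) :
    Π x : M, TangentSpace I x :=
  fun x ↦ (1 / 2 : ℝ) • (S x (ζ x) + J x (S x (J x (ζ x))))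

/-- `∂̄_{T_{X,J}} S (ξ, η)` for a `T_{X,J}`-valued `1`-form `S`.  It is the sum of
* the `(1,1)`-form `∂̄ (S^{1,0})`, whose value on `(ξ^{0,1}, η^{1,0})` is
  `∂̄_ξ (S^{1,0} η) - S^{1,0} [ξ^{0,1}, η^{1,0}]^{1,0}`, and
* the `(0,2)`-form `∂̄ (S^{0,1})`, whose value on `(ξ^{0,1}, η^{0,1})` is
  `∂̄_ξ (S^{0,1} η) - ∂̄_η (S^{0,1} ξ) - S^{0,1} [ξ^{0,1}, η^{0,1}]^{0,1}`. -/
def dbarForm (J S : SmoothEnd I M) (ξ η : Π x : M, TangentSpace I x) :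
    Π x : M, TangentSpace I x :=
  ((dbarField J ξ (part10 J S η) - part10 J S (dbarField J ξ η))
      - (dbarField J η (part10 J S ξ) - part10 J S (dbarField J η ξ)))
    + (dbarField J ξ (part01 J S η) - dbarField J η (part01 J S ξ)
      - part01 J S (real01 J (bracketC (toC01 J ξ) (toC01 J η))))

/-- The covariant exterior derivative
`∇_{T_X,g} S (ξ, η) = ∇_ξ (S η) - ∇_η (S ξ) - S [ξ, η]` of the `T_X`-valued `1`-form `S`. -/
def extCovDeriv (g : SmoothMetric I M) (S : SmoothEnd I M) (ξ η : Π x : M, TangentSpace I x) :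
    Π x : M, TangentSpace I x :=
  fun x ↦ leviCivita g (S.onField η) x (ξ x) - leviCivita g (S.onField ξ) x (η x)
    - S x (mlieBracket I ξ η x)

/-- `∂^g_{T_{X,J}} S`, the component of type `(1,0)` of the covariant exterior derivative:
`∇_{T_X,g} = ∂^g_{T_{X,J}} + ∂̄_{T_{X,J}}`. -/
def delForm (g : SmoothMetric I M) (J S : SmoothEnd I M) (ξ η : Π x : M, TangentSpace I x) :
    Π x : M, TangentSpace I x :=
  extCovDeriv g S ξ η - dbarForm J S ξ η

/-- The form `α` vanishes identically: `α (ξ, η) = 0` on `U` for all smooth vector fields `ξ`, `η`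
over an arbitrary open set `U`. -/
def VanishesIdentically
    (α : (Π x : M, TangentSpace I x) → (Π x : M, TangentSpace I x) → Π x : M, TangentSpace I x) :
    Prop :=
  ∀ (U : Set M), IsOpen U → ∀ ξ η : Π x : M, TangentSpace I x,
    ContMDiffOn I I.tangent ∞ (fun x ↦ (⟨x, ξ x⟩ : TangentBundle I M)) U →
    ContMDiffOn I I.tangent ∞ (fun x ↦ (⟨x, η x⟩ : TangentBundle I M)) U →
    ∀ x ∈ U, α ξ η x = 0

end KahlerGeometry

section KahlerCalculus

open Bundle NormedSpace VectorField
open scoped Manifold ContDiff Topology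

variable {E : Type*} [NormedAddCommGroup E] [NormedSpace ℝ E]
  {H : Type*} [TopologicalSpace H] {I : ModelWithCorners ℝ E H}
  {M : Type*} [TopologicalSpace M] [ChartedSpace H M] [IsManifold I ∞ M]
  [FiniteDimensional ℝ E]

/-! Everything takes place in the tensor `∇_g S(ξ, η)`, written `covDot g S x η ξ` with the
differentiating direction `ξ` last. Since `∇J = 0`, a commutation or anticommutation of `S` with `J`
passes to the slot `η`; since `∇g = 0`, symmetry of `S` passes to each `∇_ξ S`
(`covDot_inner_comm`).

(b) ⇔ (c): `∇` is torsion-free and preserves types, so the brackets defining `∂̄` become covariant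
derivatives. The derivatives of `ξ` and `η` cancel, and `∂̄S` is the antisymmetrization of
`∇^{0,1}S`. As `∇^{1,0}S + ∇^{0,1}S = ∇S`, subtraction gives `∂^g B` as the antisymmetrization of
`∇^{1,0}B`.

(a) ⇔ (b) is about permuting the slots of `T(ξ, η, ζ) = g(∇^{0,1}S(ξ, η), ζ)`; (a) is invariance
under `ξ ↔ ζ`. For antilinear `A`, `T` is always invariant under `η ↔ ζ`, and this transposition
conjugates `ξ ↔ ζ` into `ξ ↔ η`, which is (b). For `J`-linear `B`, exchanging `η` and `ζ` turns
`∇^{0,1}B` into `∇^{1,0}B`, so (a) becomes symmetry of `∇^{1,0}B`. -/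

/-! ### Levi-Civita calculus and transposes on a Kähler manifold. -/

theorem leviCivita_neg (g : SmoothMetric I M) {Y : Π x : M, TangentSpace I x} {x : M}
    (hY : MDiffAt (T% Y) x) : leviCivita g (-Y) x = -leviCivita g Y x := by
  have h := (leviCivita g).isCovariantDerivativeOnUniv.smul_const (-1 : ℝ) hY
  rwa [neg_one_smul, neg_one_smul] at h

theorem leviCivita_onField (g : SmoothMetric I M) (S : SmoothEnd I M)
    {η : Π x : M, TangentSpace I x} {x : M} (hη : MDiffAt (T% η) x) (v : TangentSpace I x) :
    leviCivita g (S.onField η) x v = covDot g S x (η x) v + S x (leviCivita g η x v) := by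
  rw [covDot_apply g S hη]; abel

theorem IsKahler.leviCivita_onField_self {J : SmoothEnd I M} {g : SmoothMetric I M}
    (hK : IsKahler J g) {η : Π x : M, TangentSpace I x} {x : M} (hη : MDiffAt (T% η) x)
    (v : TangentSpace I x) :
    leviCivita g (J.onField η) x v = J x (leviCivita g η x v) := by
  rw [leviCivita_onField g J hη, hK.parallel]; simp

theorem IsKahler.inner_left {J : SmoothEnd I M} {g : SmoothMetric I M}
    (hK : IsKahler J g) (x : M) (v w : TangentSpace I x) :
    g.inner x (J x v) w = -g.inner x v (J x w) := by
  have h := hK.invariant x v (J x w)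
  rw [hK.sq, map_neg] at h
  linarith

theorem mlieBracket_eq_leviCivita (g : SmoothMetric I M) {X Y : Π x : M, TangentSpace I x} {x : M}
    (hX : MDiffAt (T% X) x) (hY : MDiffAt (T% Y) x) :
    mlieBracket I X Y x = leviCivita g Y x (X x) - leviCivita g X x (Y x) :=
  ((isLeviCivita_leviCivita g).torsion_free x X Y hX hY).symm

theorem SmoothMetric.eq_transpose_iff (g : SmoothMetric I M) (x : M)
    (L : TangentSpace I x →L[ℝ] TangentSpace I x) :
    L = g.transpose x L ↔ ∀ v w, g.inner x (L v) w = g.inner x v (L w) := by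
  refine ⟨fun h v w ↦ ?_, fun h ↦ ?_⟩
  · conv_lhs => rw [h]
    exact g.inner_transpose x L v w
  · ext v
    apply (g.flat_bijective x).1
    ext w
    rw [h, g.inner_transpose]

theorem SmoothMetric.ext_inner (g : SmoothMetric I M) {x : M} {v w : TangentSpace I x}
    (h : ∀ u, g.inner x v u = g.inner x w u) : v = w :=
  (g.flat_bijective x).1 (ContinuousLinearMap.ext h)

/-! ### Symmetries of the tensor `∇_g S`. -/

/-- Differentiate `g(SY, Z) = g(Y, SZ)` along `ξ` by metric compatibility; the terms in `∇_ξ Y` and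
`∇_ξ Z` cancel by the symmetry of `S`. -/
theorem covDot_inner_comm (g : SmoothMetric I M) (S : SmoothEnd I M)
    (hS : ∀ x : M, S x = g.transpose x (S x)) (x : M) (ξ η ζ : TangentSpace I x) :
    g.inner x (covDot g S x η ξ) ζ = g.inner x (covDot g S x ζ ξ) η := by
  have hsymm (y : M) := (g.eq_transpose_iff y (S y)).1 (hS y)
  obtain ⟨Y, hY, rfl⟩ : ∃ Y : Π x : M, TangentSpace I x, MDiffAt (T% Y) x ∧ Y x = η :=
    ⟨FiberBundle.extend E η, FiberBundle.mdifferentiableAt_extend .., by simp⟩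
  obtain ⟨Z, hZ, rfl⟩ : ∃ Z : Π x : M, TangentSpace I x, MDiffAt (T% Z) x ∧ Z x = ζ :=
    ⟨FiberBundle.extend E ζ, FiberBundle.mdifferentiableAt_extend .., by simp⟩
  have h1 := (isLeviCivita_leviCivita g).metric x ξ _ _ (S.mdifferentiableAt_onField hY) hZ
  have h2 := (isLeviCivita_leviCivita g).metric x ξ _ _ hY (S.mdifferentiableAt_onField hZ)
  have h3 : (fun y ↦ g.inner y (S.onField Y y) (Z y)) =
      fun y ↦ g.inner y (Y y) (S.onField Z y) := funext fun y ↦ hsymm y _ _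
  rw [h3, h2, leviCivita_onField g S hY, leviCivita_onField g S hZ] at h1
  simp only [SmoothEnd.onField, map_add, add_apply] at h1
  rw [hsymm, hsymm, g.symm x (Y x) (covDot g S x (Z x) ξ)] at h1
  linarith

/-- Differentiate `SJ = JS`, with `J` a constant because it is parallel. -/
theorem IsKahler.covDot_comp_of_commute {J : SmoothEnd I M} {g : SmoothMetric I M}
    (hK : IsKahler J g) (S : SmoothEnd I M)
    (hS : ∀ (x : M) (v : TangentSpace I x), S x (J x v) = J x (S x v))
    (x : M) (ξ η : TangentSpace I x) :
    covDot g S x (J x η) ξ = J x (covDot g S x η ξ) := by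
  obtain ⟨Y, hY, rfl⟩ : ∃ Y : Π x : M, TangentSpace I x, MDiffAt (T% Y) x ∧ Y x = η :=
    ⟨FiberBundle.extend E η, FiberBundle.mdifferentiableAt_extend .., by simp⟩
  have h : S.onField (J.onField Y) = J.onField (S.onField Y) := funext fun y ↦ hS y _
  have h1 := covDot_apply g S (J.mdifferentiableAt_onField hY) ξ
  rw [h, hK.leviCivita_onField_self (S.mdifferentiableAt_onField hY), hK.leviCivita_onField_self hY, hS,
    leviCivita_onField g S hY, map_add, add_sub_cancel_right] at h1
  exact h1

theorem IsKahler.covDot_comp_of_anticommute {J : SmoothEnd I M} {g : SmoothMetric I M}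
    (hK : IsKahler J g) (S : SmoothEnd I M)
    (hS : ∀ (x : M) (v : TangentSpace I x), S x (J x v) = -(J x (S x v)))
    (x : M) (ξ η : TangentSpace I x) :
    covDot g S x (J x η) ξ = -(J x (covDot g S x η ξ)) := by
  obtain ⟨Y, hY, rfl⟩ : ∃ Y : Π x : M, TangentSpace I x, MDiffAt (T% Y) x ∧ Y x = η :=
    ⟨FiberBundle.extend E η, FiberBundle.mdifferentiableAt_extend .., by simp⟩
  have h : S.onField (J.onField Y) = -J.onField (S.onField Y) := funext fun y ↦ hS y _
  have h1 := covDot_apply g S (J.mdifferentiableAt_onField hY) ξ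
  rw [h, leviCivita_neg g (J.mdifferentiableAt_onField (S.mdifferentiableAt_onField hY)),
    neg_apply, hK.leviCivita_onField_self (S.mdifferentiableAt_onField hY), hK.leviCivita_onField_self hY,
    hS, leviCivita_onField g S hY, map_add, neg_add, sub_neg_eq_add, neg_add_cancel_right] at h1
  exact h1

/-! ### The `∂̄` and `∂^g` operators in terms of the Levi-Civita connection. -/

theorem cov01_eq (g : SmoothMetric I M) (J S : SmoothEnd I M) (x : M) (ξ η : TangentSpace I x) :
    cov01 g J S x ξ η = (1 / 2 : ℝ) • (covDot g S x η ξ + J x (covDot g S x η (J x ξ))) := rfl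

theorem cov10_eq (g : SmoothMetric I M) (J S : SmoothEnd I M) (x : M) (ξ η : TangentSpace I x) :
    cov10 g J S x ξ η = (1 / 2 : ℝ) • (covDot g S x η ξ - J x (covDot g S x η (J x ξ))) := rfl

/-- On a Kähler manifold `∂̄_ξ η = ½ (∇_ξ η + J ∇_{Jξ} η)`. -/
theorem IsKahler.dbarField_eq {J : SmoothEnd I M} {g : SmoothMetric I M} (hK : IsKahler J g)
    {ξ η : Π x : M, TangentSpace I x} {x : M} (hξ : MDiffAt (T% ξ) x) (hη : MDiffAt (T% η) x) :
    dbarField J ξ η x =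
      (1 / 2 : ℝ) • (leviCivita g η x (ξ x) + J x (leviCivita g η x (J x (ξ x)))) := by
  have hJξ := J.mdifferentiableAt_onField hξ
  have hJη := J.mdifferentiableAt_onField hη
  simp only [dbarField, real10, bracketC, toC01, toC10]
  rw [mlieBracket_const_smul_left hξ, mlieBracket_const_smul_left hξ,
    mlieBracket_const_smul_left hJξ, mlieBracket_const_smul_left hJξ,
    mlieBracket_const_smul_right hη, mlieBracket_const_smul_right hη,
    mlieBracket_const_smul_right hJη, mlieBracket_const_smul_right hJη,
    mlieBracket_eq_leviCivita g hξ hη, mlieBracket_eq_leviCivita g hξ hJη,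
    mlieBracket_eq_leviCivita g hJξ hη, mlieBracket_eq_leviCivita g hJξ hJη]
  -- Because `∇J = 0`, `∇ξ^{0,1}` is of type `(0,1)`, so the derivatives of `ξ` drop out of the
  -- `(1,0)`-component.
  simp only [hK.leviCivita_onField_self hξ, hK.leviCivita_onField_self hη]
  simp only [SmoothEnd.onField, map_add, map_sub, map_smul, hK.sq]
  module

/-- The bracket is `∇_{ξ^{0,1}} η^{0,1} - ∇_{η^{0,1}} ξ^{0,1}`, already of type `(0,1)`.
Multiplication by `i` acts on `T^{0,1}` as `-J`, whence the minus signs in front of `J`. -/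
theorem IsKahler.real01_bracketC_eq {J : SmoothEnd I M} {g : SmoothMetric I M} (hK : IsKahler J g)
    {ξ η : Π x : M, TangentSpace I x} {x : M} (hξ : MDiffAt (T% ξ) x) (hη : MDiffAt (T% η) x) :
    real01 J (bracketC (toC01 J ξ) (toC01 J η)) x =
      (1 / 2 : ℝ) • ((leviCivita g η x (ξ x) - J x (leviCivita g η x (J x (ξ x))))
        - (leviCivita g ξ x (η x) - J x (leviCivita g ξ x (J x (η x))))) := by
  have hJξ := J.mdifferentiableAt_onField hξ
  have hJη := J.mdifferentiableAt_onField hη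
  simp only [real01, bracketC, toC01]
  rw [mlieBracket_const_smul_left hξ, mlieBracket_const_smul_left hξ,
    mlieBracket_const_smul_left hJξ, mlieBracket_const_smul_left hJξ,
    mlieBracket_const_smul_right hη, mlieBracket_const_smul_right hη,
    mlieBracket_const_smul_right hJη, mlieBracket_const_smul_right hJη,
    mlieBracket_eq_leviCivita g hξ hη, mlieBracket_eq_leviCivita g hξ hJη,
    mlieBracket_eq_leviCivita g hJξ hη, mlieBracket_eq_leviCivita g hJξ hJη]
  simp only [hK.leviCivita_onField_self hξ, hK.leviCivita_onField_self hη]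
  simp only [SmoothEnd.onField, map_add, map_sub, map_smul, hK.sq]
  module

omit [FiniteDimensional ℝ E] in
theorem dbarField_zero_right (J : SmoothEnd I M) (ξ : Π x : M, TangentSpace I x) :
    dbarField J ξ 0 = 0 := by
  have h : J.onField (0 : Π x : M, TangentSpace I x) = 0 := by
    funext y; simp [SmoothEnd.onField]
  funext x
  simp [dbarField, real10, bracketC, toC10, h]

/-- Only the `(0,2)`-form survives. Moving `S` past `J` turns the leftover `½(S∇_ξ η + JS∇_{Jξ} η)`
into `½S(∇_ξ η - J∇_{Jξ} η)`, which the bracket term cancels. -/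
theorem IsKahler.dbarForm_eq_of_anticommute {J : SmoothEnd I M} {g : SmoothMetric I M}
    (hK : IsKahler J g) (S : SmoothEnd I M)
    (hS : ∀ (x : M) (v : TangentSpace I x), S x (J x v) = -(J x (S x v)))
    {ξ η : Π x : M, TangentSpace I x} {x : M} (hξ : MDiffAt (T% ξ) x) (hη : MDiffAt (T% η) x) :
    dbarForm J S ξ η x = cov01 g J S x (ξ x) (η x) - cov01 g J S x (η x) (ξ x) := by
  have h10 (ζ : Π x : M, TangentSpace I x) : part10 J S ζ = 0 := by
    funext y
    simp [part10, hS, hK.sq]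
  have h01 (ζ : Π x : M, TangentSpace I x) : part01 J S ζ = S.onField ζ := by
    funext y
    simp only [part01, SmoothEnd.onField, hS, map_neg, hK.sq]
    module
  simp only [dbarForm, h10, h01, dbarField_zero_right, Pi.add_apply, Pi.sub_apply, Pi.zero_apply]
  rw [hK.dbarField_eq hξ (S.mdifferentiableAt_onField hη),
    hK.dbarField_eq hη (S.mdifferentiableAt_onField hξ)]
  simp only [leviCivita_onField g S hξ, leviCivita_onField g S hη]
  rw [SmoothEnd.onField, hK.real01_bracketC_eq hξ hη, cov01_eq, cov01_eq]
  simp only [map_add, map_sub, map_smul, hS]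
  module

/-- Only the `(1,1)`-form survives, and the leftover of `∂̄_ξ(Sη)` is exactly `S ∂̄_ξ η`. -/
theorem IsKahler.dbarForm_eq_of_commute {J : SmoothEnd I M} {g : SmoothMetric I M}
    (hK : IsKahler J g) (S : SmoothEnd I M)
    (hS : ∀ (x : M) (v : TangentSpace I x), S x (J x v) = J x (S x v))
    {ξ η : Π x : M, TangentSpace I x} {x : M} (hξ : MDiffAt (T% ξ) x) (hη : MDiffAt (T% η) x) :
    dbarForm J S ξ η x = cov01 g J S x (ξ x) (η x) - cov01 g J S x (η x) (ξ x) := by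
  have h01 (ζ : Π x : M, TangentSpace I x) : part01 J S ζ = 0 := by
    funext y
    simp [part01, hS, hK.sq]
  have h10 (ζ : Π x : M, TangentSpace I x) : part10 J S ζ = S.onField ζ := by
    funext y
    simp only [part10, SmoothEnd.onField, hS, hK.sq]
    module
  simp only [dbarForm, h10, h01, dbarField_zero_right, Pi.add_apply, Pi.sub_apply, Pi.zero_apply]
  rw [hK.dbarField_eq hξ (S.mdifferentiableAt_onField hη),
    hK.dbarField_eq hη (S.mdifferentiableAt_onField hξ)]
  simp only [leviCivita_onField g S hξ, leviCivita_onField g S hη]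
  rw [SmoothEnd.onField, SmoothEnd.onField, hK.dbarField_eq hξ hη, hK.dbarField_eq hη hξ,
    cov01_eq, cov01_eq]
  simp only [map_add, map_smul, hS]
  module

theorem extCovDeriv_eq (g : SmoothMetric I M) (S : SmoothEnd I M)
    {ξ η : Π x : M, TangentSpace I x} {x : M} (hξ : MDiffAt (T% ξ) x) (hη : MDiffAt (T% η) x) :
    extCovDeriv g S ξ η x = covDot g S x (η x) (ξ x) - covDot g S x (ξ x) (η x) := by
  rw [extCovDeriv, leviCivita_onField g S hξ, leviCivita_onField g S hη,
    mlieBracket_eq_leviCivita g hξ hη, map_sub]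
  abel

theorem IsKahler.delForm_eq {J : SmoothEnd I M} {g : SmoothMetric I M}
    (hK : IsKahler J g) (S : SmoothEnd I M)
    (hS : ∀ (x : M) (v : TangentSpace I x), S x (J x v) = J x (S x v))
    {ξ η : Π x : M, TangentSpace I x} {x : M} (hξ : MDiffAt (T% ξ) x) (hη : MDiffAt (T% η) x) :
    delForm g J S ξ η x = cov10 g J S x (ξ x) (η x) - cov10 g J S x (η x) (ξ x) := by
  rw [delForm, Pi.sub_apply, extCovDeriv_eq g S hξ hη, hK.dbarForm_eq_of_commute S hS hξ hη,
    cov01_eq, cov01_eq, cov10_eq, cov10_eq]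
  module

/-! ### From vanishing on vector fields to symmetry of a tensor. -/

omit [FiniteDimensional ℝ E] in
/-- A form given pointwise by the antisymmetrization of a tensor `T` vanishes identically if and
only if `T` is symmetric. -/
theorem vanishesIdentically_iff_symmetric
    {α : (Π x : M, TangentSpace I x) → (Π x : M, TangentSpace I x) → Π x : M, TangentSpace I x}
    {T : Π x : M, TangentSpace I x → TangentSpace I x → TangentSpace I x}
    (h : ∀ {ξ η : Π x : M, TangentSpace I x} {x : M}, MDiffAt (T% ξ) x → MDiffAt (T% η) x →
      α ξ η x = T x (ξ x) (η x) - T x (η x) (ξ x)) :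
    VanishesIdentically α ↔ ∀ (x : M) (ξ η : TangentSpace I x), T x ξ η = T x η ξ := by
  refine ⟨fun hα x ξ η ↦ ?_, fun hT U hU ξ η hξ hη x hx ↦ ?_⟩
  · let e := trivializationAt E (TangentSpace I : M → Type _) x
    have hx : x ∈ e.baseSet := FiberBundle.mem_baseSet_trivializationAt' x
    -- The extension of `v` is constant in the trivialization at `x`, hence smooth on its base set.
    -- Fields over open sets thus suffice, and no cutoff function is needed.
    have smooth (v : TangentSpace I x) : ContMDiffOn I I.tangent ∞
        (fun y ↦ (⟨y, FiberBundle.extend E v y⟩ : TangentBundle I M)) e.baseSet := by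
      intro y hy
      rw [e.contMDiffWithinAt_section _ hy]
      exact (contMDiffOn_const (c := (e ⟨x, v⟩).2)).congr
        (fun z hz ↦ congr(($(e.apply_mk_symm hz _)).2)) y hy
    have h0 := hα e.baseSet e.open_baseSet _ _ (smooth ξ) (smooth η) x hx
    rw [h (FiberBundle.mdifferentiableAt_extend ..) (FiberBundle.mdifferentiableAt_extend ..),
      FiberBundle.extend_apply_self, FiberBundle.extend_apply_self] at h0
    exact sub_eq_zero.1 h0
  · have hUx := hU.mem_nhds hx
    rw [h ((hξ.contMDiffAt hUx).mdifferentiableAt (by simp))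
      ((hη.contMDiffAt hUx).mdifferentiableAt (by simp)), hT, sub_self]

/-! ### The two chains of equivalences. -/

theorem IsKahler.tfae_of_anticommute {J : SmoothEnd I M} {g : SmoothMetric I M}
    (hK : IsKahler J g) (A : SmoothEnd I M)
    (hA : ∀ (x : M) (v : TangentSpace I x), A x (J x v) = -(J x (A x v)))
    (hAg : ∀ x : M, A x = g.transpose x (A x)) :
    List.TFAE
      [∀ (x : M) (ξ : TangentSpace I x),
          cov01Dot g J A x ξ = g.transpose x (cov01Dot g J A x ξ),
        ∀ (x : M) (ξ η : TangentSpace I x), cov01 g J A x ξ η = cov01 g J A x η ξ,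
        VanishesIdentically (dbarForm J A)] := by
  -- In the `J` term two signs cancel: one from skewness of `J` when it moves onto `ζ`, one from
  -- antilinearity when it comes back out.
  have comm (x : M) (ξ η ζ : TangentSpace I x) :
      g.inner x (cov01 g J A x ξ η) ζ = g.inner x (cov01 g J A x ξ ζ) η := by
    have h1 := covDot_inner_comm g A hAg x ξ η ζ
    have h2 := covDot_inner_comm g A hAg x (J x ξ) η (J x ζ)
    rw [hK.covDot_comp_of_anticommute A hA, map_neg, neg_apply] at h2
    simp only [cov01_eq, map_smul, map_add, smul_apply, add_apply, hK.inner_left x _ ζ, h1, h2,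
      neg_neg]
  tfae_have 2 ↔ 3 :=
    (vanishesIdentically_iff_symmetric fun hξ hη ↦ hK.dbarForm_eq_of_anticommute A hA hξ hη).symm
  tfae_have 1 ↔ 2 := by
    simp only [g.eq_transpose_iff]
    refine ⟨fun h x ξ η ↦ g.ext_inner fun ζ ↦ ?_, fun h x η ξ ζ ↦ ?_⟩
    · have hswap (u v w : TangentSpace I x) :
          g.inner x (cov01 g J A x u v) w = g.inner x (cov01 g J A x w v) u :=
        (h x v u w).trans (g.symm x _ _)
      -- The transposition of the first two slots as the conjugate `(13)(23)(13)`.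
      rw [hswap, comm, hswap]
    · change g.inner x (cov01 g J A x ξ η) ζ = g.inner x ξ (cov01 g J A x ζ η)
      rw [comm, h, comm, g.symm]
  tfae_finish

theorem IsKahler.tfae_of_commute {J : SmoothEnd I M} {g : SmoothMetric I M}
    (hK : IsKahler J g) (B : SmoothEnd I M)
    (hB : ∀ (x : M) (v : TangentSpace I x), B x (J x v) = J x (B x v))
    (hBg : ∀ x : M, B x = g.transpose x (B x)) :
    List.TFAE
      [∀ (x : M) (ξ : TangentSpace I x),
          cov01Dot g J B x ξ = g.transpose x (cov01Dot g J B x ξ),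
        ∀ (x : M) (ξ η : TangentSpace I x), cov10 g J B x ξ η = cov10 g J B x η ξ,
        VanishesIdentically (delForm g J B)] := by
  -- Here `J` comes back out of the slot `ζ` without a sign, so the skewness sign remains and
  -- changes the type from `(0,1)` to `(1,0)`.
  have swap (x : M) (ξ η ζ : TangentSpace I x) :
      g.inner x (cov01 g J B x ξ η) ζ = g.inner x (cov10 g J B x ξ ζ) η := by
    have h1 := covDot_inner_comm g B hBg x ξ η ζ
    have h2 := covDot_inner_comm g B hBg x (J x ξ) η (J x ζ)
    rw [hK.covDot_comp_of_commute B hB] at h2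
    simp only [cov01_eq, cov10_eq, map_smul, map_add, smul_apply, add_apply,
      hK.inner_left x _ ζ, h1, h2, sub_eq_add_neg, map_neg,
      neg_apply]
  tfae_have 2 ↔ 3 :=
    (vanishesIdentically_iff_symmetric fun hξ hη ↦ hK.delForm_eq B hB hξ hη).symm
  tfae_have 1 ↔ 2 := by
    simp only [g.eq_transpose_iff]
    refine ⟨fun h x ξ η ↦ g.ext_inner fun ζ ↦ ?_, fun h x η ξ ζ ↦ ?_⟩
    · rw [← swap, ← swap, g.symm x _ ξ]
      exact h x ζ ξ η
    · change g.inner x (cov01 g J B x ξ η) ζ = g.inner x ξ (cov01 g J B x ζ η)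
      rw [g.symm x ξ, swap, swap, h]
  tfae_finish

end KahlerCalculus

theorem mainTheorem8 {E : Type*} [NormedAddCommGroup E] [NormedSpace ℝ E] [FiniteDimensional ℝ E]
    {H : Type*} [TopologicalSpace H] {I : ModelWithCorners ℝ E H}
    {M : Type*} [TopologicalSpace M] [ChartedSpace H M] [IsManifold I ∞ M]
    (J : SmoothEnd I M) (g : SmoothMetric I M) (hK : IsKahler J g) :
    (∀ A : SmoothEnd I M,
      (∀ (x : M) (v : TangentSpace I x), A x (J x v) = -(J x (A x v))) →
      (∀ x : M, A x = g.transpose x (A x)) →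
      List.TFAE
        [∀ (x : M) (ξ : TangentSpace I x),
            cov01Dot g J A x ξ = g.transpose x (cov01Dot g J A x ξ),
          ∀ (x : M) (ξ η : TangentSpace I x), cov01 g J A x ξ η = cov01 g J A x η ξ,
          VanishesIdentically (dbarForm J A)]) ∧
    (∀ B : SmoothEnd I M,
      (∀ (x : M) (v : TangentSpace I x), B x (J x v) = J x (B x v)) →
      (∀ x : M, B x = g.transpose x (B x)) →
      List.TFAE
        [∀ (x : M) (ξ : TangentSpace I x),
            cov01Dot g J B x ξ = g.transpose x (cov01Dot g J B x ξ),
          ∀ (x : M) (ξ η : TangentSpace I x), cov10 g J B x ξ η = cov10 g J B x η ξ,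
          VanishesIdentically (delForm g J B)]) := by
  exact ⟨fun A hA hAg ↦ hK.tfae_of_anticommute A hA hAg, fun B hB hBg ↦ hK.tfae_of_commute B hB hBg⟩
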